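/- Let $A$ be a simple AF C*-algebra that is not of type I, where AF means that $A$ is the norm closure of the union of an increasing sequence of finite-dimensional *-subalgebras. Let $\alpha=(\alpha_t)_{t\in\mathbb{R}}$ be a flow of $A$, i.e. a strongly continuous one-parameter group of *-automorphisms of $A$, and suppose that $\alpha$ is periodic, i.e. $\alpha_T=\mathrm{id}$ for some $T>0$. Let $\delta_\alpha=\frac{d}{dt}\alpha_t\big|_{t=0}$ be the generator of $\alpha$, with domain $\mathcal{D}(\delta_\alpha)$, the set of all $x\in A$ for which $t\mapsto\alpha_t(x)$ is norm differentiable at $t=0$. Then the following two conditions are equivalent: 1. (Condition F0) For every $\epsilon>0$ there exists $\nu>0$ such that for every $h=h^*\in\mathcal{D}(\delta_\alpha)$ with $\|h\|\le 1$ and $\|\delta_\alpha(h)\|<\nu$ there exist $k=k^*\in\mathcal{D}(\delta_\alpha)$ and $b=b^*\in A$ with $\|h-k\|<\epsilon$, $\|b\|<\epsilon$, $\delta_\alpha(k)+i(bk-kb)=0$, and finite spectrum $\mathrm{Sp}(k)$. 2. The fixed point algebra $A^\alpha=\{a\in A : \alpha_t(a)=a \text{ for all } t\in\mathbb{R}\}$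 has real rank zero. Here a unital C*-algebra has real rank zero if its invertible self-adjoint elements are norm dense in its self-adjoint elements, and a non-unital C*-algebra has real rank zero if its unitization does. The algebra $A$ is not assumed to be unital; if it is not, $\mathrm{Sp}(k)$ denotes the spectrum of $k$ in the unitization of $A$. -/

import Mathlib

/-- A C⋆-algebra is AF if it has an increasing sequence of finite-dimensional ⋆-subalgebras
whose union is dense. -/
def CStarIsAF (A : Type*) [NonUnitalCStarAlgebra A] : Prop :=
  ∃ F : ℕ → NonUnitalStarSubalgebra ℂ A,
    Monotone F ∧ (∀ n, FiniteDimensional ℂ (F n)) ∧ Dense (⋃ n, (F n : Set A))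

/-- A C⋆-algebra is simple if it is nonzero and has no closed two-sided ideals other than
zero and the whole algebra. (A closed two-sided ring ideal of a C⋆-algebra is automatically a
complex subspace, by the existence of approximate units.) -/
def CStarIsSimple (A : Type*) [NonUnitalCStarAlgebra A] : Prop :=
  Nontrivial A ∧ ∀ I : TwoSidedIdeal A, IsClosed {a : A | a ∈ I} → I = ⊥ ∨ I = ⊤

/-- A C⋆-algebra `A` is of type I if each of its nonzero quotients `A / I` contains a nonzero
abelian positive element, i.e. a positive `x ≠ 0` for which the closure of `x (A / I) x` is
commutative. Positive elements of the quotient lift to positive elements of `A`, so we write this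
with a positive `x = y⋆ y` in `A` and with membership in the closed ideal `I`. -/
def CStarIsTypeI (A : Type*) [NonUnitalCStarAlgebra A] : Prop :=
  ∀ I : TwoSidedIdeal A, IsClosed {a : A | a ∈ I} → I ≠ ⊤ →
    ∃ x : A, (∃ y : A, x = star y * y) ∧ x ∉ I ∧
      ∀ a b : A, (x * a * x) * (x * b * x) - (x * b * x) * (x * a * x) ∈ I

/-- A unital C⋆-algebra has real rank zero if its invertible self-adjoint elements are dense in
its self-adjoint elements. -/
def UnitalRealRankZero (B : Type*) [CStarAlgebra B] : Prop :=
  ∀ a : B, IsSelfAdjoint a → a ∈ closure {b : B | IsSelfAdjoint b ∧ IsUnit b}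

/-- A (not necessarily unital) C⋆-algebra has real rank zero if its unitization has.
(If `B` already has a unit then `Unitization ℂ B` is isomorphic to `B ⊕ ℂ`, so that this is the
same as `UnitalRealRankZero B`.) -/
def RealRankZero (B : Type*) [NonUnitalCStarAlgebra B] : Prop :=
  UnitalRealRankZero (Unitization ℂ B)

/-- A flow of a C⋆-algebra: a strongly continuous one-parameter group of ⋆-automorphisms. -/
structure CStarFlow (A : Type*) [NonUnitalCStarAlgebra A] where
  /-- The automorphism at time `t`. -/
  aut : ℝ → (A ≃⋆ₐ[ℂ] A)
  aut_zero : ∀ a : A, aut 0 a = a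
  aut_add : ∀ (s t : ℝ) (a : A), aut (s + t) a = aut s (aut t a)
  continuous_aut : ∀ a : A, Continuous fun t : ℝ => aut t a

namespace CStarFlow

variable {A : Type*} [NonUnitalCStarAlgebra A] (α : CStarFlow A)

/-- The flow is periodic if `α_T = id` for some `T > 0`. -/
def IsPeriodic : Prop := ∃ T : ℝ, 0 < T ∧ ∀ a : A, α.aut T a = a

/-- The domain of the generator: the elements whose orbit is differentiable at time zero
(in norm). -/
def generatorDomain : Set A := {a : A | DifferentiableAt ℝ (fun t : ℝ => α.aut t a) 0}

/-- The generator `a ↦ d/dt α_t(a) |_{t = 0}`; meaningful on `generatorDomain`. -/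
noncomputable def generator (a : A) : A := deriv (fun t : ℝ => α.aut t a) 0

/-- Condition F0. Finiteness of the spectrum of an element of a possibly non-unital algebra is
expressed by the quasispectrum, which in a unital algebra is the spectrum together with `0`. -/
def ConditionF0 : Prop :=
  ∀ ε : ℝ, 0 < ε → ∃ ν : ℝ, 0 < ν ∧
    ∀ h : A, h ∈ α.generatorDomain → IsSelfAdjoint h → ‖h‖ ≤ 1 → ‖α.generator h‖ < ν →
      ∃ k b : A, k ∈ α.generatorDomain ∧ IsSelfAdjoint k ∧ IsSelfAdjoint b ∧
        ‖h - k‖ < ε ∧ ‖b‖ < ε ∧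
        α.generator k + ((Complex.I • b) * k - k * (Complex.I • b)) = 0 ∧
        (quasispectrum ℂ k).Finite

/-- The fixed point algebra `{a | α_t(a) = a for all t}`. -/
def fixedPointAlgebra : NonUnitalStarSubalgebra ℂ A where
  carrier := {a : A | ∀ t : ℝ, α.aut t a = a}
  add_mem' := by
    intro a b ha hb t
    rw [map_add, ha t, hb t]
  zero_mem' := by
    intro t
    exact map_zero _
  mul_mem' := by
    intro a b ha hb t
    rw [map_mul, ha t, hb t]
  smul_mem' := by
    intro c a ha t
    rw [map_smul, ha t]
  star_mem' := by
    intro a ha t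
    rw [map_star, ha t]

/-- The fixed point algebra is norm closed, hence a C⋆-algebra. -/
instance isClosed_fixedPointAlgebra : IsClosed (α.fixedPointAlgebra : Set A) := by
  have h : (α.fixedPointAlgebra : Set A) = ⋂ t : ℝ, {a : A | α.aut t a = a} := by
    ext a
    rw [Set.mem_iInter]
    exact Iff.rfl
  rw [h]
  refine isClosed_iInter fun t => isClosed_eq ?_ continuous_id
  exact (NonUnitalStarAlgHom.isometry (α.aut t) (α.aut t).injective).continuous

end CStarFlow

/-! Averaging over a period maps `A` into the fixed point algebra and moves an element by at most
the period times the norm of its generator. If the fixed point algebra has real rank zero, average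
`h` and approximate the mean by a fixed element of finite spectrum; then `b = 0` works. Conversely,
F0 puts near a fixed self-adjoint element some `x` of finite spectrum killed by the derivation `δ +
[c, ·]`, with `c` small. The sign `s` of `x` is a polynomial in `x`, so it is killed too, and
`‖δ(s)‖` is of order `‖c‖` however small the spectral gaps of `x` are. Hence the mean of `s` is
close to `s`. Adding `η` times this mean to the original element gives a fixed element near the
invertible `x + η s`. -/

/-! ### Functional calculus and finite spectrum. -/

/-- In a C⋆-algebra of real rank zero, self-adjoint elements of finite spectrum are dense. -/
theorem UnitalRealRankZero.exists_finite_spectrum {B : Type*} [CStarAlgebra B]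
    (hB : UnitalRealRankZero B) {a : B} (ha : IsSelfAdjoint a) {ε : ℝ} (hε : 0 < ε) :
    ∃ b : B, IsSelfAdjoint b ∧ (spectrum ℂ b).Finite ∧ ‖a - b‖ < ε := by
  set m : ℝ := ε / 2 with hm
  have hm0 : 0 < m := by positivity
  let U : ℤ → Set (selfAdjoint B) := fun n =>
    {y | IsUnit ((y : B) - algebraMap ℝ B (n * m))}
  have hopen : ∀ n, IsOpen (U n) := fun n =>
    Units.isOpen.preimage (continuous_subtype_val.sub continuous_const)
  have hdense : ∀ n, Dense (U n) := by
    intro n y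
    have hc : IsSelfAdjoint (algebraMap ℝ B (n * m)) := .algebraMap B (.all _)
    have h1 := hB _ (y.2.sub hc)
    rw [Metric.mem_closure_iff] at h1 ⊢
    intro r hr
    obtain ⟨b, ⟨hb, hbu⟩, hd⟩ := h1 r hr
    refine ⟨⟨b + algebraMap ℝ B (n * m), hb.add hc⟩, by simpa [U] using hbu, ?_⟩
    rw [Subtype.dist_eq, dist_eq_norm]
    rw [dist_eq_norm] at hd
    rwa [sub_sub, add_comm] at hd
  have : CompleteSpace (selfAdjoint B) :=
    (isClosed_eq continuous_star continuous_id : IsClosed {x : B | star x = x}).completeSpace_coe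
  -- Baire: a dense set of self-adjoint elements has spectrum missing the whole grid `m ℤ`.
  have hall := dense_iInter_of_isOpen hopen hdense
  obtain ⟨y, hyd, hy⟩ : ∃ y : selfAdjoint B, dist (⟨a, ha⟩ : selfAdjoint B) y < m ∧
      y ∈ ⋂ n, U n := by
    obtain ⟨y, hy, hd⟩ := Metric.mem_closure_iff.1 (hall ⟨a, ha⟩) m hm0
    exact ⟨y, hd, hy⟩
  have hysa : IsSelfAdjoint (y : B) := y.2
  have hgrid : ∀ x ∈ spectrum ℝ (y : B), ∀ n : ℤ, x ≠ n * m := by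
    rintro x hx n rfl
    refine hx (spectrum.mem_resolventSet_iff.2 ?_)
    have := (Set.mem_iInter.1 hy n : IsUnit _).neg
    rwa [neg_sub] at this
  -- Rounding down to the grid is locally constant off the grid, hence continuous on the spectrum.
  let f : ℝ → ℝ := fun x => m * ⌊x / m⌋
  have hfc : ContinuousOn f (spectrum ℝ (y : B)) := by
    intro x hx
    have hx' : x / m ≠ (⌊x / m⌋ : ℝ) := fun h => hgrid x hx ⌊x / m⌋ (by
      rw [← h]; field_simp)
    have hev : f =ᶠ[nhds x] fun _ => m * ⌊x / m⌋ := by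
      have hopen' : IsOpen ((fun z : ℝ => z / m) ⁻¹' Set.Ioo (⌊x / m⌋ : ℝ) (⌊x / m⌋ + 1)) :=
        isOpen_Ioo.preimage (continuous_id.div_const m)
      filter_upwards [hopen'.mem_nhds ⟨lt_of_le_of_ne (Int.floor_le _) hx'.symm,
        Int.lt_floor_add_one _⟩] with z hz
      have : ⌊z / m⌋ = ⌊x / m⌋ := Int.floor_eq_iff.2 ⟨hz.1.le, hz.2⟩
      simp only [f, this]
    exact (continuousAt_const.congr hev.symm).continuousWithinAt
  have hfin : (f '' spectrum ℝ (y : B)).Finite := by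
    obtain ⟨R, hR⟩ := (spectrum.isCompact (𝕜 := ℝ) (y : B)).isBounded.exists_norm_le
    have : f '' spectrum ℝ (y : B) ⊆ (fun n : ℤ => m * (n : ℝ)) '' Set.Icc ⌊-R / m⌋ ⌊R / m⌋ := by
      rintro _ ⟨x, hx, rfl⟩
      have h := abs_le.1 (hR x hx)
      exact ⟨⌊x / m⌋, ⟨Int.floor_le_floor (by gcongr; exact h.1),
        Int.floor_le_floor (by gcongr; exact h.2)⟩, rfl⟩
    exact ((Set.finite_Icc _ _).image _).subset this
  have hsa : IsSelfAdjoint (cfc f (y : B)) := cfc_predicate f (y : B)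
  refine ⟨cfc f (y : B), hsa, ?_, ?_⟩
  · rw [← hsa.spectrumRestricts.algebraMap_image, cfc_map_spectrum f (y : B)]
    exact hfin.image _
  · have h1 : ‖(y : B) - cfc f (y : B)‖ ≤ m := by
      have hid : (y : B) - cfc f (y : B) = cfc (fun x => x - f x) (y : B) := by
        rw [cfc_sub (fun x => x) f (y : B), cfc_id' ℝ (y : B)]
      rw [hid]
      · refine norm_cfc_le hm0.le fun x _ => ?_
        rw [Real.norm_eq_abs, abs_le]
        have h2 := Int.floor_le (x / m)
        have h3 := (Int.lt_floor_add_one (x / m)).le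
        have h4 : x = m * (x / m) := by field_simp
        have h5 : m * ⌊x / m⌋ ≤ m * (x / m) := by gcongr
        have h6 : m * (x / m) ≤ m * (⌊x / m⌋ + 1) := by gcongr
        simp only [f]
        constructor <;> linarith
    have h2 : ‖a - y‖ < m := by simpa [Subtype.dist_eq, dist_eq_norm] using hyd
    calc ‖a - cfc f (y : B)‖ = ‖(a - y) + (y - cfc f (y : B))‖ := by rw [sub_add_sub_cancel]
      _ ≤ ‖a - y‖ + ‖(y : B) - cfc f (y : B)‖ := norm_add_le _ _
      _ < m + m := by linarith
      _ = ε := by rw [hm]; ring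

/-- For a self-adjoint `x` of finite spectrum the sign of `x` is a polynomial `s` in `x`, and
`x + η • s` is invertible with inverse of norm at most `η⁻¹`. -/
theorem exists_polynomial_sign {B : Type*} [CStarAlgebra B] {x : B} (hx : IsSelfAdjoint x)
    (hfin : (spectrum ℂ x).Finite) {η : ℝ} (hη : 0 < η) :
    ∃ P : Polynomial ℝ, IsSelfAdjoint (Polynomial.aeval x P) ∧ ‖Polynomial.aeval x P‖ ≤ 1 ∧
      ∃ u : Bˣ, (u : B) = x + η • Polynomial.aeval x P ∧ ‖(↑u⁻¹ : B)‖ ≤ η⁻¹ := by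
  have hfinR : (spectrum ℝ x).Finite := by
    rw [← hx.spectrumRestricts.algebraMap_image] at hfin
    exact hfin.of_finite_image (algebraMap ℝ ℂ).injective.injOn
  -- The value at zero must be nonzero, so that `|r + η * sg r| ≥ η` holds at `r = 0` as well.
  let sg : ℝ → ℝ := fun r => if 0 ≤ r then 1 else -1
  let P : Polynomial ℝ := Lagrange.interpolate hfinR.toFinset id sg
  have hP : ∀ r ∈ spectrum ℝ x, P.eval r = sg r := fun r hr =>
    Lagrange.eval_interpolate_at_node (v := id) sg (Function.injective_id.injOn)
      (hfinR.mem_toFinset.2 hr)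
  have hcfc : Polynomial.aeval x P = cfc P.eval x := (cfc_polynomial P x hx).symm
  let g : ℝ → ℝ := fun r => r + η * P.eval r
  have hg : ∀ r ∈ spectrum ℝ x, η ≤ |g r| := by
    intro r hr
    simp only [g, hP r hr, sg]
    split_ifs with h
    · exact le_trans (by linarith) (le_abs_self _)
    · exact le_trans (by linarith) (neg_le_abs _)
  have hg0 : ∀ r ∈ spectrum ℝ x, g r ≠ 0 := fun r hr h => by
    have := hg r hr
    rw [h, abs_zero] at this
    linarith
  have hgc : ContinuousOn g (spectrum ℝ x) :=
    (continuous_id.add (continuous_const.mul P.continuous)).continuousOn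
  have hgx : cfc g x = x + η • Polynomial.aeval x P := by
    rw [hcfc, cfc_add (a := x) (fun r => r) (fun r => η * P.eval r) continuousOn_id
      (continuous_const.mul P.continuous).continuousOn, cfc_id' ℝ x,
      cfc_const_mul η P.eval x P.continuous.continuousOn]
  refine ⟨P, hcfc ▸ cfc_predicate P.eval x, ?_, cfcUnits g x hg0 hgc hx, ?_, ?_⟩
  · rw [hcfc]
    refine norm_cfc_le zero_le_one fun r hr => ?_
    rw [hP r hr]
    simp only [sg]
    split_ifs <;> simp
  · exact hgx
  · change ‖cfc (fun r => (g r)⁻¹) x‖ ≤ _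
    refine norm_cfc_le (by positivity) fun r hr => ?_
    rw [norm_inv, Real.norm_eq_abs]
    exact inv_anti₀ hη (hg r hr)

/-! ### Orbits and their means. -/

namespace CStarFlow

variable {A : Type*} [NonUnitalCStarAlgebra A] (α : CStarFlow A)

theorem norm_aut (t : ℝ) (a : A) : ‖α.aut t a‖ = ‖a‖ :=
  NonUnitalStarAlgHom.norm_map (α.aut t) (α.aut t).injective a

/-- The automorphism at time `t` as a real-linear isometry. -/
noncomputable def autLinearIsometry (t : ℝ) : A →ₗᵢ[ℝ] A where
  toFun := α.aut t
  map_add' := map_add _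
  map_smul' r a := by
    rw [← Complex.coe_smul, map_smul, RingHom.id_apply, Complex.coe_smul]
  norm_map' := α.norm_aut t

/-- The group law transports differentiability from time zero to every time. -/
theorem hasDerivAt_aut {a d : A} (h : HasDerivAt (fun t : ℝ => α.aut t a) d 0) (t : ℝ) :
    HasDerivAt (fun s : ℝ => α.aut s a) (α.aut t d) t := by
  have h0 : HasDerivAt (fun s : ℝ => α.aut s a) d (t - t) := by rwa [sub_self]
  have h1 := h0.comp_sub_const t t
  have h2 := (α.autLinearIsometry t).toContinuousLinearMap.hasFDerivAt.comp_hasDerivAt t h1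
  refine h2.congr_of_eventuallyEq (Filter.Eventually.of_forall fun s => ?_)
  change α.aut s a = α.aut t (α.aut (s - t) a)
  rw [← α.aut_add, add_sub_cancel]

theorem norm_aut_sub_le {a d : A} (h : HasDerivAt (fun t : ℝ => α.aut t a) d 0) (t : ℝ) :
    ‖α.aut t a - a‖ ≤ ‖d‖ * |t| := by
  have := convex_univ.norm_image_sub_le_of_norm_hasDerivWithin_le (C := ‖d‖) (x := (0 : ℝ)) (y := t)
    (fun s _ => (α.hasDerivAt_aut h s).hasDerivWithinAt) (fun s _ => (α.norm_aut s d).le)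
    (Set.mem_univ _) (Set.mem_univ _)
  simpa [α.aut_zero] using this

/-- The mean of the orbit of `a` over `[0, T]`. -/
noncomputable def mean (T : ℝ) (a : A) : A := T⁻¹ • ∫ t in (0 : ℝ)..T, α.aut t a

theorem isSelfAdjoint_mean (T : ℝ) {a : A} (ha : IsSelfAdjoint a) :
    IsSelfAdjoint (α.mean T a) := by
  have h : star (∫ t in (0 : ℝ)..T, α.aut t a) = ∫ t in (0 : ℝ)..T, α.aut t a := by
    have := (starL' ℝ (A := A)).toContinuousLinearMap.intervalIntegral_comp_comm
      ((α.continuous_aut a).intervalIntegrable (μ := MeasureTheory.volume) 0 T)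
    change _ = star _ at this
    rw [← this]
    refine intervalIntegral.integral_congr fun t _ => ?_
    change star (α.aut t a) = _
    rw [← map_star, ha.star_eq]
  rw [IsSelfAdjoint, mean, star_smul, h, star_trivial]

/-- Applying `α.aut s` shifts the window of integration, which does not change the integral of a
`T`-periodic orbit. -/
theorem mean_mem_fixedPointAlgebra {T : ℝ} (hT : ∀ a : A, α.aut T a = a) (a : A) :
    α.mean T a ∈ α.fixedPointAlgebra := by
  intro s
  have hp : Function.Periodic (fun t => α.aut t a) T := fun t => by
    simp only [α.aut_add, hT]
  have h := (α.autLinearIsometry s).toContinuousLinearMap.intervalIntegral_comp_comm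
    ((α.continuous_aut a).intervalIntegrable (μ := MeasureTheory.volume) 0 T)
  have h2 : ∫ t in (0 : ℝ)..T, α.aut s (α.aut t a) = ∫ t in (0 : ℝ)..T, α.aut t a := by
    have h3 := hp.intervalIntegral_add_eq s 0
    simp only [← α.aut_add]
    rw [intervalIntegral.integral_comp_add_left (fun t => α.aut t a) s, add_zero, h3, zero_add]
  change α.autLinearIsometry s _ = _
  rw [mean, map_smul]
  congr 1
  exact h.symm.trans h2

theorem norm_mean_sub_le {T : ℝ} (hT : 0 < T) {a d : A}
    (h : HasDerivAt (fun t : ℝ => α.aut t a) d 0) : ‖α.mean T a - a‖ ≤ ‖d‖ * T := by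
  have h1 : α.mean T a - a = T⁻¹ • ∫ t in (0 : ℝ)..T, (α.aut t a - a) := by
    rw [intervalIntegral.integral_sub ((α.continuous_aut a).intervalIntegrable 0 T)
      intervalIntegrable_const, intervalIntegral.integral_const, smul_sub, sub_zero, smul_smul,
      inv_mul_cancel₀ hT.ne', one_smul, mean]
  have h2 : ‖∫ t in (0 : ℝ)..T, (α.aut t a - a)‖ ≤ ‖d‖ * T * |T - 0| := by
    refine intervalIntegral.norm_integral_le_of_norm_le_const fun t ht => ?_
    rw [Set.uIoc_of_le hT.le] at ht
    refine (α.norm_aut_sub_le h t).trans ?_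
    rw [abs_of_pos ht.1]
    gcongr
    exact ht.2
  rw [h1, norm_smul, norm_inv, Real.norm_eq_abs, abs_of_pos hT]
  rw [sub_zero, abs_of_pos hT] at h2
  calc T⁻¹ * _ ≤ T⁻¹ * (‖d‖ * T * T) := by gcongr
    _ = ‖d‖ * T := by field_simp

theorem hasDerivAt_of_mem_fixedPointAlgebra {a : A} (ha : a ∈ α.fixedPointAlgebra) :
    HasDerivAt (fun t : ℝ => α.aut t a) 0 0 := by
  have : (fun t : ℝ => α.aut t a) = fun _ => a := funext ha
  rw [this]
  exact hasDerivAt_const _ _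

/-! ### Passage to unitizations. -/

open Unitization

/-- The elements of the unitization annihilated by the perturbed generator `δ + [c, ·]`. -/
def perturbedKernel (c : A) : Subalgebra ℝ (Unitization ℂ A) where
  carrier := {x | HasDerivAt (fun t : ℝ => α.aut t x.snd) (x.snd * c - c * x.snd) 0}
  mul_mem' {x y} hx hy := by
    simp only [Set.mem_ofPred_eq, snd_mul, map_add, map_mul, map_smul] at *
    have := ((hy.const_smul x.fst).add (hx.const_smul y.fst)).add 
      ((ContinuousLinearMap.mul ℝ A).hasDerivAt_of_bilinear (fun _ => hx) fun _ => hy)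
    refine this.congr_deriv ?_
    simp only [ContinuousLinearMap.mul_apply', α.aut_zero, mul_add, add_mul, mul_sub, sub_mul, smul_sub, smul_mul_assoc,
      mul_smul_comm, mul_assoc]
    abel
  add_mem' {x y} hx hy := by
    simp only [Set.mem_ofPred_eq, snd_add, map_add] at *
    refine (hx.add hy).congr_deriv ?_
    rw [mul_add, add_mul]
    abel
  algebraMap_mem' r := by
    have : (algebraMap ℝ (Unitization ℂ A) r).snd = 0 := rfl
    simp only [Set.mem_ofPred_eq, this, map_zero, zero_mul, mul_zero, sub_zero]
    exact hasDerivAt_const _ _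

theorem norm_fst_le (x : Unitization ℂ A) : ‖x.fst‖ ≤ ‖x‖ :=
  NonUnitalStarAlgHom.norm_apply_le ({ fstHom ℂ A with map_star' := fun _ => rfl } : Unitization ℂ A →⋆ₐ[ℂ] ℂ) x

theorem norm_snd_le (x : Unitization ℂ A) : ‖x.snd‖ ≤ 2 * ‖x‖ := by
  have h : (x.snd : Unitization ℂ A) = x - algebraMap ℂ _ x.fst := by
    rw [eq_sub_iff_add_eq, add_comm]
    exact inl_fst_add_inr_snd_eq x
  calc ‖x.snd‖ = ‖(x.snd : Unitization ℂ A)‖ := (norm_inr _).symm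
    _ ≤ ‖x‖ + ‖x.fst‖ := by
      rw [h]
      refine (norm_sub_le _ _).trans_eq ?_
      rw [norm_algebraMap']
    _ ≤ 2 * ‖x‖ := by linarith [norm_fst_le x]

end CStarFlow

namespace CStarFlow

variable {A : Type*} [NonUnitalCStarAlgebra A] (α : CStarFlow A)

open Unitization

/-- The inclusion of the unitized fixed point algebra into the unitization of `A`. -/
noncomputable def unitizationInclusion :
    Unitization ℂ α.fixedPointAlgebra →⋆ₐ[ℂ] Unitization ℂ A :=
  starMap (NonUnitalStarSubalgebraClass.subtype α.fixedPointAlgebra)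

theorem unitizationInclusion_apply (x : Unitization ℂ α.fixedPointAlgebra) :
    α.unitizationInclusion x = inl x.fst + inr (x.snd : A) := by
  conv_lhs => rw [← inl_fst_add_inr_snd_eq x, map_add]
  rw [unitizationInclusion, starMap_inl, starMap_inr]
  rfl

theorem unitizationInclusion_injective : Function.Injective α.unitizationInclusion :=
  starMap_injective Subtype.coe_injective

/-- The unitized flow fixes `u`, hence its inverse by uniqueness of inverses. -/
theorem isUnit_of_isUnit_unitizationInclusion {x : Unitization ℂ α.fixedPointAlgebra}
    (hx : IsUnit (α.unitizationInclusion x)) : IsUnit x := by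
  obtain ⟨u, hu⟩ := hx
  have hinv : ∀ t : ℝ, α.aut t (↑u⁻¹ : Unitization ℂ A).snd = (↑u⁻¹ : Unitization ℂ A).snd := by
    intro t
    let φ : Unitization ℂ A →⋆ₐ[ℂ] Unitization ℂ A :=
      starMap (α.aut t : A →⋆ₙₐ[ℂ] A)
    have hφ : ∀ z : Unitization ℂ A, φ z = inl z.fst + inr (α.aut t z.snd) := by
      intro z
      conv_lhs => rw [← inl_fst_add_inr_snd_eq z, map_add]
      simp only [φ]
      rw [starMap_inl, starMap_inr]
      rfl
    have hφu : φ u = u := by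
      rw [hφ, hu, α.unitizationInclusion_apply]
      ext
      · simp
      · simpa using x.snd.2 t
    have h1 : φ ↑u⁻¹ = ↑u⁻¹ := by
      refine eq_comm.1 (Units.inv_eq_of_mul_eq_one_right ?_)
      rw [← hφu, ← map_mul]
      simp
    have h2 := congrArg (fun z : Unitization ℂ A => z.snd) h1
    rw [hφ] at h2
    simpa using h2
  let w : Unitization ℂ α.fixedPointAlgebra :=
    inl (↑u⁻¹ : Unitization ℂ A).fst + inr ⟨(↑u⁻¹ : Unitization ℂ A).snd, hinv⟩
  have hw : α.unitizationInclusion w = ↑u⁻¹ := by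
    rw [α.unitizationInclusion_apply]
    ext <;> simp [w]
  refine ⟨⟨x, w, α.unitizationInclusion_injective ?_, α.unitizationInclusion_injective ?_⟩, rfl⟩
  · rw [map_mul, hw, ← hu, map_one, Units.mul_inv]
  · rw [map_mul, hw, ← hu, map_one, Units.inv_mul]

/-! ### The two implications. -/

variable {α}

/-- Rescaling removes the bound `‖h‖ ≤ 1` of F0. The generator vanishes on fixed elements, so any
`ν` will do. -/
theorem ConditionF0.exists_near (hF : α.ConditionF0) {h : A} (hfix : h ∈ α.fixedPointAlgebra)
    (hsa : IsSelfAdjoint h) {ε : ℝ} (hε : 0 < ε) :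
    ∃ k c : A, IsSelfAdjoint k ∧ ‖h - k‖ < ε ∧ ‖c‖ < ε ∧
      HasDerivAt (fun t : ℝ => α.aut t k) (k * c - c * k) 0 ∧
      (spectrum ℂ (k : Unitization ℂ A)).Finite := by
  -- `M ≥ 1` is needed because `b` is not rescaled: its bound `ε / M` must still be at most `ε`.
  set M : ℝ := ‖h‖ + 1 with hM
  have hM1 : 1 ≤ M := by linarith [norm_nonneg h]
  have hM0 : 0 < M := by linarith
  obtain ⟨ν, hν, H⟩ := hF (ε / M) (by positivity)
  have hfix' : M⁻¹ • h ∈ α.fixedPointAlgebra := by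
    rw [← Complex.coe_smul]
    exact SMulMemClass.smul_mem _ hfix
  have hd := α.hasDerivAt_of_mem_fixedPointAlgebra hfix'
  obtain ⟨k, b, hkd, hk, -, hhk, hb, hgen, hfin⟩ := H (M⁻¹ • h) hd.differentiableAt
    ((IsSelfAdjoint.all _).smul hsa) (by
      rw [norm_smul, norm_inv, Real.norm_eq_abs, abs_of_pos hM0, inv_mul_le_one₀ hM0]
      linarith) (by
      rw [generator, hd.deriv, norm_zero]
      exact hν)
  refine ⟨M • k, Complex.I • b, (IsSelfAdjoint.all _).smul hk, ?_, ?_, ?_, ?_⟩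
  · have : h - M • k = M • (M⁻¹ • h - k) := by
      rw [smul_sub, smul_smul, mul_inv_cancel₀ hM0.ne', one_smul]
    rw [this, norm_smul, Real.norm_eq_abs, abs_of_pos hM0]
    calc M * _ < M * (ε / M) := by gcongr
      _ = ε := by field_simp
  · rw [norm_smul, Complex.norm_I, one_mul]
    exact hb.trans_le (div_le_self hε.le hM1)
  · have h1 : HasDerivAt (fun t : ℝ => α.aut t k) (α.generator k) 0 :=
      DifferentiableAt.hasDerivAt hkd
    rw [eq_neg_of_add_eq_zero_left hgen] at h1
    have h2 := h1.const_smul M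
    have h3 : (fun t : ℝ => α.aut t (M • k)) = fun t => M • α.aut t k :=
      funext fun t => map_smul (α.autLinearIsometry t) M k
    rw [h3]
    refine h2.congr_deriv ?_
    rw [neg_sub, smul_sub, smul_mul_assoc M, mul_smul_comm M]
  · rw [quasispectrum_eq_spectrum_inr] at hfin
    have : ((M • k : A) : Unitization ℂ A) = (Units.mk0 (M : ℂ) (by exact_mod_cast hM0.ne')) •
        (k : Unitization ℂ A) := by
      rw [← Complex.coe_smul, inr_smul]
      rfl
    rw [this, spectrum.unit_smul_eq_smul]
    exact hfin.image _

theorem ConditionF0.realRankZero (hF : α.ConditionF0) (hper : α.IsPeriodic) :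
    RealRankZero α.fixedPointAlgebra := by
  obtain ⟨T, hT, hTper⟩ := hper
  intro a ha
  rw [Metric.mem_closure_iff]
  intro r hr
  -- The correction `v` below has norm at most 4, so `η • v` stays below `r`.
  set η : ℝ := r / 8 with hη
  have hη0 : 0 < η := by positivity
  -- The first bound keeps the total error within the radius `η` of invertibility; the second gives
  -- the mean norm at most 3.
  obtain ⟨ε, hε0, hε1, hε2⟩ : ∃ ε : ℝ, 0 < ε ∧ ε * (1 + 4 * η * T) < η ∧ 4 * ε * T < 1 := by
    have h1 : Filter.Tendsto (fun ε : ℝ => ε * (1 + 4 * η * T)) (nhdsWithin 0 (Set.Ioi 0))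
        (nhds 0) := by
      have : Continuous fun ε : ℝ => ε * (1 + 4 * η * T) := by fun_prop
      simpa using (this.tendsto 0).mono_left nhdsWithin_le_nhds
    have h2 : Filter.Tendsto (fun ε : ℝ => 4 * ε * T) (nhdsWithin 0 (Set.Ioi 0)) (nhds 0) := by
      have : Continuous fun ε : ℝ => 4 * ε * T := by fun_prop
      simpa using (this.tendsto 0).mono_left nhdsWithin_le_nhds
    obtain ⟨ε, h3, h4, h5⟩ := (eventually_mem_nhdsWithin.and
      ((h1.eventually_lt_const hη0).and (h2.eventually_lt_const one_pos))).exists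
    exact ⟨ε, h3, h4, h5⟩
  have ha1 : IsSelfAdjoint a.fst := congrArg (fun z : Unitization ℂ α.fixedPointAlgebra => z.fst) ha.star_eq
  have ha2 : IsSelfAdjoint (a.snd : A) :=
    congrArg (fun z : Unitization ℂ α.fixedPointAlgebra => (z.snd : A)) ha.star_eq
  obtain ⟨k, c, hk, hhk, hc, hkd, hfin⟩ := hF.exists_near a.snd.2 ha2 hε0
  set x : Unitization ℂ A := algebraMap ℂ _ a.fst + (k : Unitization ℂ A) with hx
  have hxsa : IsSelfAdjoint x := (IsSelfAdjoint.algebraMap _ ha1).add (hk.inr ℂ)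
  have hxfin : (spectrum ℂ x).Finite := by
    rw [hx, ← spectrum.singleton_add_eq]
    exact (Set.finite_singleton _).add hfin
  obtain ⟨P, hssa, hs1, u, hu, hu1⟩ := exists_polynomial_sign hxsa hxfin hη0
  set s := Polynomial.aeval x P with hs
  have hxk : x ∈ α.perturbedKernel c := by
    change HasDerivAt (fun t : ℝ => α.aut t x.snd) (x.snd * c - c * x.snd) 0
    have : x.snd = k := by
      rw [hx]
      exact zero_add k
    rwa [this]
  have hsk : HasDerivAt (fun t : ℝ => α.aut t s.snd) (s.snd * c - c * s.snd) 0 := by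
    have h1 := Polynomial.aeval_mem_adjoin_singleton ℝ x (p := P)
    exact (Algebra.adjoin_le (Set.singleton_subset_iff.2 hxk) : _ ≤ α.perturbedKernel c) h1
  have hs2 : ‖s.snd‖ ≤ 2 := (norm_snd_le s).trans (by linarith)
  have hsfst : ‖s.fst‖ ≤ 1 := (norm_fst_le s).trans hs1
  have hδ : ‖s.snd * c - c * s.snd‖ ≤ 4 * ε := by
    calc _ ≤ ‖s.snd * c‖ + ‖c * s.snd‖ := norm_sub_le _ _
      _ ≤ ‖s.snd‖ * ‖c‖ + ‖c‖ * ‖s.snd‖ := add_le_add (norm_mul_le _ _) (norm_mul_le _ _)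
      _ ≤ 2 * ε + ε * 2 := by gcongr
      _ = 4 * ε := by ring
  have hmean : ‖α.mean T s.snd - s.snd‖ ≤ 4 * ε * T :=
    (α.norm_mean_sub_le hT hsk).trans (by gcongr)
  have hmean2 : ‖α.mean T s.snd‖ ≤ 3 := by
    have := norm_add_le (α.mean T s.snd - s.snd) s.snd
    rw [sub_add_cancel] at this
    linarith
  have hs1sa : IsSelfAdjoint s.fst := congrArg (fun z : Unitization ℂ A => z.fst) hssa.star_eq
  have hs2sa : IsSelfAdjoint s.snd := congrArg (fun z : Unitization ℂ A => z.snd) hssa.star_eq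
  let p : α.fixedPointAlgebra := ⟨α.mean T s.snd, α.mean_mem_fixedPointAlgebra hTper _⟩
  let v : Unitization ℂ α.fixedPointAlgebra := algebraMap ℂ _ s.fst + (p : Unitization ℂ _)
  have hpsa : IsSelfAdjoint p := Subtype.ext (α.isSelfAdjoint_mean T hs2sa)
  have hvsa : IsSelfAdjoint v := (IsSelfAdjoint.algebraMap _ hs1sa).add (hpsa.inr ℂ)
  have hv : ‖v‖ ≤ 4 := by
    calc ‖v‖ ≤ ‖s.fst‖ + ‖p‖ := by
          refine (norm_add_le _ _).trans_eq ?_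
          rw [norm_algebraMap', norm_inr]
      _ ≤ 1 + 3 := add_le_add hsfst hmean2
      _ = 4 := by norm_num
  refine ⟨a + η • v, ⟨ha.add ((IsSelfAdjoint.all _).smul hvsa), ?_⟩, ?_⟩
  · apply α.isUnit_of_isUnit_unitizationInclusion
    have hdiff : α.unitizationInclusion (a + η • v) - u =
        (((a.snd : A) - k : A) : Unitization ℂ A) +
          η • ((α.mean T s.snd - s.snd : A) : Unitization ℂ A) := by
      have hv' : α.unitizationInclusion v = algebraMap ℂ _ s.fst + (α.mean T s.snd : A) := by
        rw [α.unitizationInclusion_apply]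
        ext <;> simp [v, p, algebraMap_eq_inl]
      have hs' : s = algebraMap ℂ _ s.fst + (s.snd : Unitization ℂ A) :=
        (inl_fst_add_inr_snd_eq s).symm
      have ha' : α.unitizationInclusion a = algebraMap ℂ _ a.fst + (a.snd : A) :=
        α.unitizationInclusion_apply a
      have hηv : α.unitizationInclusion (η • v) = η • α.unitizationInclusion v := by
        rw [← Complex.coe_smul, map_smul, Complex.coe_smul]
      have hsub : η • s = η • (algebraMap ℂ _ s.fst + (s.snd : Unitization ℂ A)) := by
        rw [← hs']
      rw [map_add, hηv, hv', ha', hu, hsub, hx, inr_sub, inr_sub]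
      simp only [smul_add, smul_sub]
      abel
    have hlt : ‖α.unitizationInclusion (a + η • v) - u‖ < ‖(↑u⁻¹ : Unitization ℂ A)‖⁻¹ := by
      have h1 : ‖α.unitizationInclusion (a + η • v) - u‖ < η := by
        rw [hdiff]
        calc _ ≤ ‖(a.snd : A) - k‖ + η * ‖α.mean T s.snd - s.snd‖ := by
              refine (norm_add_le _ _).trans_eq ?_
              rw [norm_smul, norm_inr, norm_inr, Real.norm_eq_abs, abs_of_pos hη0]
          _ ≤ ε + η * (4 * ε * T) := by gcongr
          _ = ε * (1 + 4 * η * T) := by ring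
          _ < η := hε1
      have h2 : 0 < ‖(↑u⁻¹ : Unitization ℂ A)‖ := norm_pos_iff.2 u⁻¹.ne_zero
      exact h1.trans_le ((le_inv_comm₀ h2 hη0).1 hu1)
    -- Neumann series: the distance to `u` is less than `η ≤ ‖u⁻¹‖⁻¹`.
    exact (u.ofNearby _ hlt).isUnit
  · rw [dist_self_add_right, norm_smul, Real.norm_eq_abs, abs_of_pos hη0]
    calc η * ‖v‖ ≤ η * 4 := by gcongr
      _ < r := by rw [hη]; linarith

theorem conditionF0_of_realRankZero (hR : RealRankZero α.fixedPointAlgebra)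
    (hper : α.IsPeriodic) : α.ConditionF0 := by
  obtain ⟨T, hT, hTper⟩ := hper
  intro ε hε
  -- Averaging costs `ε / 2`. The other half becomes `ε / 4` in the unitization, since taking `snd`
  -- may double norms.
  refine ⟨ε / (2 * T), by positivity, fun h hd hsa _ hδ => ?_⟩
  have hmean : ‖α.mean T h - h‖ < ε / 2 := by
    calc _ ≤ ‖α.generator h‖ * T := α.norm_mean_sub_le hT (DifferentiableAt.hasDerivAt hd)
      _ < ε / (2 * T) * T := by gcongr
      _ = ε / 2 := by field_simp
  let m : α.fixedPointAlgebra := ⟨α.mean T h, α.mean_mem_fixedPointAlgebra hTper h⟩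
  have hm : IsSelfAdjoint m := Subtype.ext (α.isSelfAdjoint_mean T hsa)
  obtain ⟨y, hysa, hyfin, hy⟩ :=
    hR.exists_finite_spectrum (hm.inr ℂ) (show 0 < ε / 4 by positivity)
  have hk : (y.snd : Unitization ℂ α.fixedPointAlgebra) = algebraMap ℂ _ (-y.fst) + y := by
    rw [map_neg, eq_neg_add_iff_add_eq]
    exact inl_fst_add_inr_snd_eq y
  have hkfin : (quasispectrum ℂ y.snd).Finite := by
    rw [quasispectrum_eq_spectrum_inr, hk, ← spectrum.singleton_add_eq]
    exact (Set.finite_singleton _).add hyfin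
  have hkd := α.hasDerivAt_of_mem_fixedPointAlgebra y.snd.2
  have hnear : ‖α.mean T h - y.snd‖ ≤ 2 * (ε / 4) := by
    have h1 := norm_snd_le ((m : Unitization ℂ α.fixedPointAlgebra) - y)
    have h2 : ((m : Unitization ℂ α.fixedPointAlgebra) - y).snd = m - y.snd := rfl
    rw [h2] at h1
    refine le_trans (le_of_eq ?_) (h1.trans (by gcongr))
    rfl
  refine ⟨y.snd, 0, hkd.differentiableAt,
    congrArg (fun z : Unitization ℂ α.fixedPointAlgebra => (z.snd : A)) hysa.star_eq,
    .zero A, ?_, by simpa using hε, ?_, ?_⟩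
  · calc ‖h - y.snd‖ = ‖-(α.mean T h - h) + (α.mean T h - y.snd)‖ := by congr 1; abel
      _ ≤ ‖α.mean T h - h‖ + ‖α.mean T h - y.snd‖ := by
        simpa only [norm_neg] using norm_add_le (-(α.mean T h - h)) (α.mean T h - y.snd)
      _ < ε / 2 + 2 * (ε / 4) := by linarith
      _ = ε := by ring
  · rw [generator, hkd.deriv]
    simp
  · exact hkfin.subset (NonUnitalAlgHom.quasispectrum_apply_subset
      (NonUnitalStarSubalgebraClass.subtype α.fixedPointAlgebra) y.snd)

end CStarFlow


theorem proposition3p7 {A : Type*} [NonUnitalCStarAlgebra A]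
    (hAF : CStarIsAF A) (hsimple : CStarIsSimple A) (hnotI : ¬ CStarIsTypeI A)
    (α : CStarFlow A) (hper : α.IsPeriodic) :
    α.ConditionF0 ↔ RealRankZero α.fixedPointAlgebra := by
  exact ⟨fun h => h.realRankZero hper, fun h => CStarFlow.conditionF0_of_realRankZero h hper⟩
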